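/- Let $\mathcal{C}$ be any nonempty class of Leibniz quantum compact metric spaces. For all $(\mathfrak{A},\mathsf{L}_{\mathfrak{A}}),(\mathfrak{B},\mathsf{L}_{\mathfrak{B}})\in\mathcal{C}$, $$\operatorname{dist}_q\big((\mathfrak{A},\mathsf{L}_{\mathfrak{A}}),(\mathfrak{B},\mathsf{L}_{\mathfrak{B}})\big)\;\le\;2\,\mathsf{\Lambda}_{\mathcal{C}}\big((\mathfrak{A},\mathsf{L}_{\mathfrak{A}}),(\mathfrak{B},\mathsf{L}_{\mathfrak{B}})\big),$$ where $\mathsf{\Lambda}_{\mathcal{C}}$ is the quantum Gromov–Hausdorff $\mathcal{C}$-propinquity and $\operatorname{dist}_q$ is Rieffel's quantum Gromov–Hausdorff distance. In particular, if a net in $\mathcal{C}$ converges to an element of $\mathcal{C}$ for $\mathsf{\Lambda}_{\mathcal{C}}$, then it converges to the same limit for $\operatorname{dist}_q$. Here the notions are as follows. *Spaces.* A unital Lipschitz pair $(\mathfrak{A},\mathsf{L})$ is a unital C*-algebra $\mathfrak{A}$ with a seminorm $\mathsf{L}$ defined on a dense subspace $\operatorname{dom}(\mathsf{L})$ of the self-adjoint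 part $\mathfrak{sa}(\mathfrak{A})$, extended by $\mathsf{L}=\infty$ outside $\operatorname{dom}(\mathsf{L})$, such that $\{\mathsf{L}=0\}=\mathbb{R}1_{\mathfrak{A}}$. Its Monge–Kantorovich metric on the state space $\mathscr{S}(\mathfrak{A})$ is $\mathsf{mk}_{\mathsf{L}}(\varphi,\psi)=\sup\{|\varphi(a)-\psi(a)|: a\in\mathfrak{sa}(\mathfrak{A}),\ \mathsf{L}(a)\le 1\}$. If $\mathsf{mk}_{\mathsf{L}}$ induces the weak* topology, then $(\mathfrak{A},\mathsf{L})$ is a quantum compact metric space and $\mathsf{L}$ is a Lip-norm. It is a Leibniz quantum compact metric space if moreover $\mathsf{L}$ is lower semicontinuous for the norm and, for all $a,b\in\mathfrak{sa}(\mathfrak{A})$, both $\mathsf{L}\big(\tfrac{ab+ba}{2}\big)$ and $\mathsf{L}\big(\tfrac{ab-ba}{2i}\big)$ are at most $\|a\|\mathsf{L}(b)+\|b\|\mathsf{L}(a)$ (with $0\cdot\infty=0$). *Bridges.* The $1$-level $\mathscr{S}_1(\omega)$ of an element $\omega$ of a unital C*-algebra $\mathfrak{D}$ is the set of states $\varphi$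 of $\mathfrak{D}$ with $\varphi((1-\omega)^*(1-\omega))=0=\varphi((1-\omega)(1-\omega)^*)$. A bridge $\gamma=(\mathfrak{D},\omega,\pi_{\mathfrak{A}},\pi_{\mathfrak{B}})$ from $\mathfrak{A}$ to $\mathfrak{B}$ consists of a unital C*-algebra $\mathfrak{D}$, an element $\omega\in\mathfrak{D}$ with $\mathscr{S}_1(\omega)\neq\emptyset$, and unital $*$-monomorphisms $\pi_{\mathfrak{A}}:\mathfrak{A}\to\mathfrak{D}$ and $\pi_{\mathfrak{B}}:\mathfrak{B}\to\mathfrak{D}$. Its reach is the Hausdorff distance, for the norm of $\mathfrak{D}$, between $\{\pi_{\mathfrak{A}}(a)\omega: a\in\mathfrak{sa}(\mathfrak{A}),\ \mathsf{L}_{\mathfrak{A}}(a)\le1\}$ and $\{\omega\pi_{\mathfrak{B}}(b): b\in\mathfrak{sa}(\mathfrak{B}),\ \mathsf{L}_{\mathfrak{B}}(b)\le1\}$. Its height is the larger of the two Hausdorff distances between $\mathscr{S}(\mathfrak{A})$ and $\{\varphi\circ\pi_{\mathfrak{A}}:\varphi\in\mathscr{S}_1(\omega)\}$ for $\mathsf{mk}_{\mathsf{L}_{\mathfrak{A}}}$,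 and between $\mathscr{S}(\mathfrak{B})$ and $\{\varphi\circ\pi_{\mathfrak{B}}:\varphi\in\mathscr{S}_1(\omega)\}$ for $\mathsf{mk}_{\mathsf{L}_{\mathfrak{B}}}$. Its length is the maximum of its reach and its height. *Propinquity.* A $\mathcal{C}$-trek from $(\mathfrak{A},\mathsf{L}_{\mathfrak{A}})$ to $(\mathfrak{B},\mathsf{L}_{\mathfrak{B}})$ is a finite sequence $(\mathfrak{A}_1,\mathsf{L}_1),\dots,(\mathfrak{A}_{n+1},\mathsf{L}_{n+1})$ in $\mathcal{C}$, $n\ge1$, starting at the first space and ending at the second, with a bridge $\gamma_j$ from $\mathfrak{A}_j$ to $\mathfrak{A}_{j+1}$ for each $j=1,\dots,n$; its length is the sum of the lengths of the $\gamma_j$. $\mathsf{\Lambda}_{\mathcal{C}}$ is the infimum of the lengths of all $\mathcal{C}$-treks. (When $\mathcal{C}$ is the class of all Leibniz quantum compact metric spaces, $\mathsf{\Lambda}_{\mathcal{C}}$ is the quantum Gromov–Hausdorff propinquity.) *Rieffel's distance.* $\operatorname{dist}_q$ is the infimum, over all Lip-norms $\mathsf{L}$ on $\mathfrak{A}\oplus\mathfrak{B}$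 with domain $\operatorname{dom}(\mathsf{L}_{\mathfrak{A}})\oplus\operatorname{dom}(\mathsf{L}_{\mathfrak{B}})$ that satisfy $\mathsf{L}_{\mathfrak{A}}(a)=\inf_{b}\mathsf{L}(a,b)$ and $\mathsf{L}_{\mathfrak{B}}(b)=\inf_{a}\mathsf{L}(a,b)$ for all self-adjoint $a$ and $b$, of the Hausdorff distance for $\mathsf{mk}_{\mathsf{L}}$ between $\mathscr{S}(\mathfrak{A})$ and $\mathscr{S}(\mathfrak{B})$, both viewed inside $\mathscr{S}(\mathfrak{A}\oplus\mathfrak{B})$ by composing states with the coordinate projections. -/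

import Mathlib

open Filter Topology
open scoped ENNReal ComplexOrder CStarAlgebra

universe u v

noncomputable section

namespace QuantumMetric

section States

variable {A : Type u} [CStarAlgebra A] {B : Type u} [CStarAlgebra B]

/-- The state space of a unital C*-algebra, as a subset of the dual with its weak* topology. -/
def stateSpace (A : Type u) [CStarAlgebra A] : Set (WeakDual ℂ A) :=
  {φ | (∀ a : A, 0 ≤ φ (star a * a)) ∧ φ 1 = 1}

/-- States, with the weak* topology (the subspace topology from `WeakDual ℂ A`). -/
abbrev State (A : Type u) [CStarAlgebra A] : Type u := stateSpace A

/-- The dual map `φ ↦ φ ∘ π` of a unital star-homomorphism. -/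
def State.comap (π : A →⋆ₐ[ℂ] B) (φ : State B) : State A :=
  ⟨StrongDual.toWeakDual
      ((WeakDual.toStrongDual φ.1).comp (⟨π.toAlgHom.toLinearMap, map_continuous π⟩ : A →L[ℂ] B)),
    fun a => by
      have h := φ.2.1 (π a)
      rw [← map_star, ← map_mul] at h
      exact h,
    by
      have h := φ.2.2
      rw [← map_one π] at h
      exact h⟩

theorem State.comap_apply (π : A →⋆ₐ[ℂ] B) (φ : State B) (a : A) :
    (State.comap π φ).1 a = φ.1 (π a) := rfl

/-- The Monge-Kantorovich metric of `L`, where `L` takes the value `∞` off its domain. -/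
def mkDist (L : selfAdjoint A → ℝ≥0∞) (φ ψ : State A) : ℝ≥0∞ :=
  ⨆ (a : selfAdjoint A) (_ : L a ≤ 1), edist (φ.1 (a : A)) (ψ.1 (a : A))

/-- The Monge-Kantorovich metric as an extended (pseudo)metric structure on the state space. -/
abbrev mkSpace (L : selfAdjoint A → ℝ≥0∞) : PseudoEMetricSpace (State A) where
  edist := mkDist L
  edist_self φ := by simp [mkDist]
  edist_comm φ ψ := by simp only [mkDist, edist_comm]
  edist_triangle φ ψ χ := by
    refine iSup₂_le fun a ha => (edist_triangle _ (ψ.1 (a : A)) _).trans ?_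
    exact add_le_add
      (le_iSup₂ (f := fun (a : selfAdjoint A) (_ : L a ≤ 1) =>
        edist (φ.1 (a : A)) (ψ.1 (a : A))) a ha)
      (le_iSup₂ (f := fun (a : selfAdjoint A) (_ : L a ≤ 1) =>
        edist (ψ.1 (a : A)) (χ.1 (a : A))) a ha)

/-- The Hausdorff distance between sets of states for the Monge-Kantorovich metric of `L`. -/
def mkHausdorff (L : selfAdjoint A → ℝ≥0∞) (S T : Set (State A)) : ℝ≥0∞ :=
  @Metric.hausdorffEDist (State A) (mkSpace L) S T

end States

section LipNorms

variable {A : Type u} [CStarAlgebra A]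

/-- `L` is a seminorm defined on a dense subspace of the self-adjoint part of `A` (extended by
`∞` off that subspace) whose null space is `ℝ 1`. -/
structure IsLipschitzPair (L : selfAdjoint A → ℝ≥0∞) : Prop where
  add_le : ∀ a b, L (a + b) ≤ L a + L b
  smul_eq : ∀ (r : ℝ) (a), L (r • a) = ‖r‖ₑ * L a
  dense_dom : Dense {a | L a < ∞}
  eq_zero_iff : ∀ a, L a = 0 ↔ ∃ r : ℝ, a = r • (1 : selfAdjoint A)

/-- `L` is a Lip-norm: its Monge-Kantorovich metric induces the weak* topology on the states. -/
structure IsLipNorm (L : selfAdjoint A → ℝ≥0∞) : Prop extends IsLipschitzPair L where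
  topology_eq : (mkSpace L).toUniformSpace.toTopologicalSpace =
    (inferInstance : TopologicalSpace (State A))

/-- The Jordan product `(ab + ba) / 2`. -/
def jordan (a b : selfAdjoint A) : selfAdjoint A :=
  ⟨(1 / 2 : ℂ) • ((a : A) * b + b * a), by
    rw [selfAdjoint.mem_iff, star_smul, star_add, star_mul, star_mul, selfAdjoint.star_val_eq,
      selfAdjoint.star_val_eq, add_comm ((b : A) * a)]
    simp⟩

/-- The Lie product `(ab - ba) / 2i`. -/
def lie (a b : selfAdjoint A) : selfAdjoint A :=
  ⟨(1 / (2 * Complex.I) : ℂ) • ((a : A) * b - b * a), by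
    rw [selfAdjoint.mem_iff, star_smul, star_sub, star_mul, star_mul, selfAdjoint.star_val_eq,
      selfAdjoint.star_val_eq, ← neg_sub ((a : A) * b), smul_neg, ← neg_smul]
    congr 1
    simp⟩

/-- The Leibniz property for the Jordan and the Lie product. -/
def HasLeibniz (L : selfAdjoint A → ℝ≥0∞) : Prop :=
  ∀ a b, L (jordan a b) ≤ ‖(a : A)‖ₑ * L b + ‖(b : A)‖ₑ * L a ∧
    L (lie a b) ≤ ‖(a : A)‖ₑ * L b + ‖(b : A)‖ₑ * L a

end LipNorms

/-- Quantum compact metric spaces. -/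
structure QCMS : Type (u + 1) where
  carrier : Type u
  [str : CStarAlgebra carrier]
  lip : selfAdjoint carrier → ℝ≥0∞
  isLipNorm : IsLipNorm lip

attribute [instance] QCMS.str

instance : CoeSort QCMS.{u} (Type u) := ⟨QCMS.carrier⟩

/-- Leibniz quantum compact metric spaces. -/
structure QCMS.IsLeibniz (X : QCMS.{u}) : Prop where
  leibniz : HasLeibniz X.lip
  lowerSemicontinuous : LowerSemicontinuous X.lip

section Bridges

/-- The 1-level of an element. -/
def oneLevel {D : Type u} [CStarAlgebra D] (ω : D) : Set (State D) :=
  {φ | φ.1 (star (1 - ω) * (1 - ω)) = 0 ∧ φ.1 ((1 - ω) * star (1 - ω)) = 0}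

/-- Bridges from `A` to `B`. -/
structure Bridge (A B : Type u) [CStarAlgebra A] [CStarAlgebra B] : Type (u + 1) where
  D : Type u
  [str : CStarAlgebra D]
  pivot : D
  left : A →⋆ₐ[ℂ] D
  right : B →⋆ₐ[ℂ] D
  left_injective : Function.Injective left
  right_injective : Function.Injective right
  oneLevel_nonempty : (oneLevel pivot).Nonempty

attribute [instance] Bridge.str

variable {X Y : QCMS.{u}}

/-- The reach of a bridge: the Hausdorff distance, for the norm of `D`, between
`π_A {L_A ≤ 1} ω` and `ω π_B {L_B ≤ 1}`. -/
def Bridge.reach (γ : Bridge X Y) : ℝ≥0∞ :=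
  Metric.hausdorffEDist
    ((fun a : selfAdjoint X => γ.left (a : X) * γ.pivot) '' {a | X.lip a ≤ 1})
    ((fun b : selfAdjoint Y => γ.pivot * γ.right (b : Y)) '' {b | Y.lip b ≤ 1})

/-- The height of a bridge. -/
def Bridge.height (γ : Bridge X Y) : ℝ≥0∞ :=
  max (mkHausdorff X.lip Set.univ (State.comap γ.left '' oneLevel γ.pivot))
    (mkHausdorff Y.lip Set.univ (State.comap γ.right '' oneLevel γ.pivot))

/-- The length of a bridge. -/
def Bridge.length (γ : Bridge X Y) : ℝ≥0∞ := max γ.reach γ.height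

end Bridges

/-- Treks along the class `C`: finite nonempty chains of bridges between members of `C`. -/
inductive Trek (C : Set QCMS.{u}) : QCMS.{u} → QCMS.{u} → Type (u + 1)
  | single {X Y : QCMS.{u}} (hX : X ∈ C) (hY : Y ∈ C) (γ : Bridge X Y) : Trek C X Y
  | cons {X Y Z : QCMS.{u}} (hX : X ∈ C) (γ : Bridge X Y) (Γ : Trek C Y Z) : Trek C X Z

/-- The length of a trek: the sum of the lengths of its bridges. -/
def Trek.length {C : Set QCMS.{u}} : {X Y : QCMS.{u}} → Trek C X Y → ℝ≥0∞
  | _, _, .single _ _ γ => γ.length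
  | _, _, .cons _ γ Γ => γ.length + Γ.length

/-- The quantum Gromov-Hausdorff `C`-propinquity. -/
def propinquity (C : Set QCMS.{u}) (X Y : QCMS.{u}) : ℝ≥0∞ :=
  ⨅ Γ : Trek C X Y, Γ.length

section QuantumGromovHausdorff

variable {A B : Type u} [CStarAlgebra A] [CStarAlgebra B]

/-- The self-adjoint element `(a, b)` of `A ⊕ B`. -/
def saPair (a : selfAdjoint A) (b : selfAdjoint B) : selfAdjoint (A × B) :=
  ⟨((a : A), (b : B)), by
    rw [selfAdjoint.mem_iff, Prod.star_def]
    simp only [selfAdjoint.star_val_eq]⟩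

/-- `L` is an admissible Lip-norm for `(LA, LB)`: a Lip-norm on `A ⊕ B` with domain
`dom LA ⊕ dom LB` whose quotient seminorms on `A` and on `B` are `LA` and `LB`. -/
structure IsAdmissible (LA : selfAdjoint A → ℝ≥0∞) (LB : selfAdjoint B → ℝ≥0∞)
    (L : selfAdjoint (A × B) → ℝ≥0∞) : Prop where
  isLipNorm : IsLipNorm L
  dom_eq : ∀ a b, L (saPair a b) < ∞ ↔ LA a < ∞ ∧ LB b < ∞
  quotient_left : ∀ a, LA a = ⨅ b, L (saPair a b)
  quotient_right : ∀ b, LB b = ⨅ a, L (saPair a b)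

/-- Rieffel's quantum Gromov-Hausdorff distance. The states of `A` and of `B` are embedded in
those of `A ⊕ B` as `φ ↦ φ ∘ pr`. -/
def distQ (X Y : QCMS.{u}) : ℝ≥0∞ :=
  ⨅ (L : selfAdjoint (X × Y) → ℝ≥0∞) (_ : IsAdmissible X.lip Y.lip L),
    mkHausdorff L (Set.range (State.comap (StarAlgHom.fst ℂ X Y)))
      (Set.range (State.comap (StarAlgHom.snd ℂ X Y)))

end QuantumGromovHausdorff

end QuantumMetric

end

noncomputable section

namespace QuantumMetric

/-! ### States, the 1-level and the Monge–Kantorovich metric -/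

section StateLemmas

variable {A : Type u} [CStarAlgebra A]

/-! A bridge with pivot `ω` and any finite `r` above its length yield the seminorm `max(L_A(a),
L_B(b), ‖π_A(a)ω - ωπ_B(b)‖ / r)` on the direct sum. Since the reach is below `r`, its quotients are
`L_A` and `L_B` (`Bridge.exists_lip_le_left`, `Bridge.exists_lip_le_right`). A state `θ` of the
1-level absorbs `ω` on either side, so its restrictions to `A` and `B` are at distance at most `r`
(`Bridge.edist_oneLevel_le`). Since the height is below `r`, every state of `A` or `B` is within `r`
of such a restriction. Hence each state lies within `2r` of a state of the other algebra, and
`dist_q` is at most twice the length of one bridge (`Bridge.distQ_le`).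

A trek is handled by the triangle inequality for `dist_q` (`distQ_triangle`), obtained by composing
admissible Lip-norms as `inf_b max(L₁(a,b), L₂(b,c))`. Both constructions are shown to be Lip-norms
by `isAdmissible_of_edist_le_mul`. -/

theorem State.cauchySchwarz (φ : State A) (a b : A) :
    ‖φ.1 (star a * b)‖ ^ 2 ≤ (φ.1 (star a * a)).re * (φ.1 (star b * b)).re := by
  let := CStarAlgebra.spectralOrder A
  let := CStarAlgebra.spectralOrderedRing A
  let f : A →ₚ[ℂ] ℂ := PositiveLinearMap.mk₀ (WeakDual.toStrongDual φ.1).toLinearMap (fun x hx => by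
    obtain ⟨y, rfl⟩ := CStarAlgebra.nonneg_iff_eq_star_mul_self.mp hx
    exact φ.2.1 y)
  have h := inner_mul_inner_self_le (𝕜 := ℂ) (f.toPreGNS a) (f.toPreGNS b)
  rw [norm_inner_symm (f.toPreGNS b), ← sq] at h
  exact h

/-- Cauchy–Schwarz against `1` gives `|φ(a)|² ≤ φ(a*a)`, and `a*a ≤ ‖a‖²·1`. -/
theorem State.norm_apply_le (φ : State A) (a : A) : ‖φ.1 a‖ ≤ ‖a‖ := by
  let := CStarAlgebra.spectralOrder A
  let := CStarAlgebra.spectralOrderedRing A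
  have h := φ.cauchySchwarz 1 a
  have hle := CStarAlgebra.star_mul_le_algebraMap_norm_sq (a := a)
  obtain ⟨y, hy⟩ := CStarAlgebra.nonneg_iff_eq_star_mul_self.mp (sub_nonneg.mpr hle)
  have h2 := φ.2.1 y
  rw [← hy, map_sub, Algebra.algebraMap_eq_smul_one, ← Complex.coe_smul, map_smul, φ.2.2] at h2
  have h3 := (Complex.le_def.mp h2).1
  simp only [star_one, one_mul, φ.2.2, Complex.one_re] at h
  simp at h3
  norm_cast at h3
  exact le_of_sq_le_sq (h.trans h3) (norm_nonneg _)

theorem State.edist_apply_le (φ : State A) (a b : A) : edist (φ.1 a) (φ.1 b) ≤ edist a b := by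
  rw [edist_eq_enorm_sub, edist_eq_enorm_sub, ← map_sub]
  exact enorm_le_iff_norm_le.mpr (φ.norm_apply_le _)

/-- By Cauchy–Schwarz, `|φ(a(1-ω))|²` is at most a multiple of `φ((1-ω)*(1-ω)) = 0`. The other
equation defining the 1-level gives absorption on the left. -/
theorem State.apply_mul_of_mem_oneLevel {ω : A} {φ : State A} (hφ : φ ∈ oneLevel ω) (a : A) :
    φ.1 (a * ω) = φ.1 a := by
  have h := φ.cauchySchwarz (star a) (1 - ω)
  rw [hφ.1, star_star, Complex.zero_re, mul_zero] at h
  have h0 : φ.1 (a * (1 - ω)) = 0 := by simpa using le_antisymm h (by positivity)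
  rw [mul_sub, mul_one, map_sub, sub_eq_zero] at h0
  exact h0.symm

theorem State.mul_apply_of_mem_oneLevel {ω : A} {φ : State A} (hφ : φ ∈ oneLevel ω) (a : A) :
    φ.1 (ω * a) = φ.1 a := by
  have h := φ.cauchySchwarz (star (1 - ω)) a
  rw [star_star, hφ.2, Complex.zero_re, zero_mul] at h
  have h0 : φ.1 ((1 - ω) * a) = 0 := by simpa using le_antisymm h (by positivity)
  rw [sub_mul, one_mul, map_sub, sub_eq_zero] at h0
  exact h0.symm

theorem State.apply_real_smul (φ : State A) (r : ℝ) (a : selfAdjoint A) :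
    φ.1 ((r • a : selfAdjoint A) : A) = (r : ℂ) * φ.1 (a : A) := by
  rw [selfAdjoint.val_smul, ← Complex.coe_smul, map_smul, smul_eq_mul]

theorem State.continuous_iff {T : Type*} [TopologicalSpace T] {f : T → State A} :
    Continuous f ↔ ∀ a : A, Continuous fun t => (f t).1 a := by
  rw [continuous_induced_rng]
  exact ⟨fun h a => (WeakDual.eval_continuous a).comp h, WeakDual.continuous_of_continuous_eval⟩

theorem edist_le_mkDist {L : selfAdjoint A → ℝ≥0∞} {a : selfAdjoint A} (ha : L a ≤ 1)
    (φ ψ : State A) : edist (φ.1 (a : A)) (ψ.1 (a : A)) ≤ mkDist L φ ψ :=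
  le_iSup₂ (f := fun (a : selfAdjoint A) (_ : L a ≤ 1) => edist (φ.1 (a : A)) (ψ.1 (a : A))) a ha

theorem mkDist_le_of_edist_le_mul {L : selfAdjoint A → ℝ≥0∞} {φ ψ : State A} {M : ℝ≥0∞}
    (h : ∀ a : selfAdjoint A, edist (φ.1 (a : A)) (ψ.1 (a : A)) ≤ M * L a) :
    mkDist L φ ψ ≤ M :=
  iSup₂_le fun a ha => (h a).trans (mul_le_of_le_one_right' ha)

theorem exists_real_smul_eq_one {L : selfAdjoint A → ℝ≥0∞}
    (smul_eq : ∀ (r : ℝ) (a), L (r • a) = ‖r‖ₑ * L a) {a : selfAdjoint A} (h0 : L a ≠ 0)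
    (ht : L a ≠ ∞) : ∃ r : ℝ, r ≠ 0 ∧ ‖r‖ₑ = (L a)⁻¹ ∧ L (r • a) = 1 := by
  have hr : ‖(L a).toReal⁻¹‖ₑ = (L a)⁻¹ := by
    rw [Real.enorm_eq_ofReal (by positivity), ENNReal.ofReal_inv_of_pos
      (ENNReal.toReal_pos h0 ht), ENNReal.ofReal_toReal ht]
  exact ⟨(L a).toReal⁻¹, inv_ne_zero (ENNReal.toReal_pos h0 ht).ne', hr, by
    rw [smul_eq, hr, ENNReal.inv_mul_cancel h0 ht]⟩

/-- Homogeneity turns the bound on the unit ball into a bound at every `a`. The strict inequality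
makes `M` positive, which matters when `L a = ∞` because `0 * ∞ = 0`. -/
theorem IsLipschitzPair.edist_le_mul {L : selfAdjoint A → ℝ≥0∞} (hL : IsLipschitzPair L)
    {φ ψ : State A} {M : ℝ≥0∞} (hM : mkDist L φ ψ < M) (a : selfAdjoint A) :
    edist (φ.1 (a : A)) (ψ.1 (a : A)) ≤ M * L a := by
  by_cases ht : L a = ∞
  · rw [ht, ENNReal.mul_top (pos_of_gt hM).ne']
    exact le_top
  by_cases h0 : L a = 0
  · obtain ⟨r, rfl⟩ := (hL.eq_zero_iff a).mp h0
    have h1 (χ : State A) : χ.1 ((1 : selfAdjoint A) : A) = 1 := χ.2.2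
    rw [State.apply_real_smul, State.apply_real_smul, h1, h1, edist_self]
    exact zero_le
  obtain ⟨r, -, hr, h1⟩ := exists_real_smul_eq_one hL.smul_eq h0 ht
  have h := (edist_le_mkDist h1.le φ ψ).trans hM.le
  rw [State.apply_real_smul, State.apply_real_smul, edist_eq_enorm_sub, ← mul_sub, enorm_mul,
    ← edist_eq_enorm_sub] at h
  have hrr : ‖(r : ℂ)‖ₑ = ‖r‖ₑ := by simp [enorm_eq_nnnorm]
  rw [hrr, hr, mul_comm, ← div_eq_mul_inv] at h
  exact (ENNReal.div_le_iff h0 ht).mp h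

theorem exists_mkDist_lt_of_mkHausdorff_lt {L : selfAdjoint A → ℝ≥0∞} {S T : Set (State A)}
    {r : ℝ≥0∞} (h : mkHausdorff L S T < r) {φ : State A} (hφ : φ ∈ S) :
    ∃ ψ ∈ T, mkDist L φ ψ < r :=
  @Metric.exists_edist_lt_of_hausdorffEDist_lt (State A) (mkSpace L) φ S T r hφ h

theorem mkHausdorff_le_of_mkDist_le {L : selfAdjoint A → ℝ≥0∞} {S T : Set (State A)} {r : ℝ≥0∞}
    (h₁ : ∀ φ ∈ S, ∃ ψ ∈ T, mkDist L φ ψ ≤ r) (h₂ : ∀ ψ ∈ T, ∃ φ ∈ S, mkDist L ψ φ ≤ r) :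
    mkHausdorff L S T ≤ r :=
  @Metric.hausdorffEDist_le_of_mem_edist (State A) (mkSpace L) S T r h₁ h₂

theorem mkHausdorff_comm (L : selfAdjoint A → ℝ≥0∞) (S T : Set (State A)) :
    mkHausdorff L S T = mkHausdorff L T S :=
  @Metric.hausdorffEDist_comm (State A) (mkSpace L) S T

theorem mkDist_comm (L : selfAdjoint A → ℝ≥0∞) (φ ψ : State A) :
    mkDist L φ ψ = mkDist L ψ φ :=
  @edist_comm (State A) (mkSpace L) φ ψ

/-- The Monge-Kantorovich metric of a Lipschitz pair is finer than the weak* topology. -/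
theorem IsLipschitzPair.mkSpace_le {L : selfAdjoint A → ℝ≥0∞} (hL : IsLipschitzPair L) :
    (mkSpace L).toUniformSpace.toTopologicalSpace ≤
      (inferInstance : TopologicalSpace (State A)) := by
  rw [← continuous_id_iff_le]
  refine (@State.continuous_iff A _ (State A) (mkSpace L).toUniformSpace.toTopologicalSpace
    id).mpr ?_
  let M := mkSpace L
  let : TopologicalSpace (State A) := M.toUniformSpace.toTopologicalSpace
  have hsa (a : selfAdjoint A) : Continuous fun φ : State A => φ.1 (a : A) := by
    rw [continuous_iff_continuousAt]
    intro φ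
    rw [ContinuousAt, EMetric.tendsto_nhds]
    intro ε hε
    have h3 : 0 < ε / 3 := ENNReal.div_pos hε.ne' (by norm_num)
    -- The metric controls only elements of finite `L`; density and the contractivity of states
    -- reach the other self-adjoint ones.
    obtain ⟨b, hb, hab⟩ := EMetric.mem_closure_iff.mp (hL.dense_dom a) (ε / 3) h3
    have hab' : edist (a : A) b < ε / 3 := hab
    obtain ⟨δ, hδ, hδb⟩ : ∃ δ > 0, δ * L b < ε / 3 := by
      obtain ⟨δ, hδ, h⟩ := ENNReal.exists_nnreal_pos_mul_lt hb.ne h3.ne'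
      exact ⟨δ, by exact_mod_cast hδ, h⟩
    filter_upwards [Metric.eball_mem_nhds φ hδ] with ψ hψ
    calc edist (ψ.1 (a : A)) (φ.1 (a : A))
        ≤ edist (ψ.1 (a : A)) (ψ.1 (b : A)) + edist (ψ.1 (b : A)) (φ.1 (b : A))
          + edist (φ.1 (b : A)) (φ.1 (a : A)) := edist_triangle4 _ _ _ _
      _ < ε / 3 + ε / 3 + ε / 3 := by
        refine ENNReal.add_lt_add (ENNReal.add_lt_add
          ((ψ.edist_apply_le _ _).trans_lt hab') ((hL.edist_le_mul hψ b).trans_lt hδb)) ?_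
        rw [edist_comm]
        exact (φ.edist_apply_le _ _).trans_lt hab'
      _ = ε := ENNReal.add_thirds ε
  intro a
  have := (hsa (realPart a)).add ((hsa (imaginaryPart a)).const_mul Complex.I)
  refine this.congr fun φ => ?_
  conv_rhs => rw [id, ← realPart_add_I_smul_imaginaryPart a, map_add, map_smul, smul_eq_mul]
  rfl

/-- The Monge-Kantorovich metric is a weak* continuous function of the first state at the second. -/
theorem IsLipNorm.eventually_mkDist_lt {L : selfAdjoint A → ℝ≥0∞} (hL : IsLipNorm L)
    (φ : State A) {ε : ℝ≥0∞} (hε : 0 < ε) : ∀ᶠ ψ in 𝓝 φ, mkDist L ψ φ < ε := by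
  have h := @Metric.eball_mem_nhds (State A) (mkSpace L) φ ε hε
  rw [hL.topology_eq] at h
  exact h

/-- One comparison of topologies holds for every Lipschitz pair, so only weak* neighbourhoods inside
metric balls have to be found. -/
theorem IsLipschitzPair.isLipNorm_of_eventually {L : selfAdjoint A → ℝ≥0∞}
    (hL : IsLipschitzPair L)
    (h : ∀ (φ : State A) (ε : ℝ≥0∞), 0 < ε → ∀ᶠ ψ in 𝓝 φ, mkDist L ψ φ ≤ ε) : IsLipNorm L where
  toIsLipschitzPair := hL
  topology_eq := by
    refine le_antisymm hL.mkSpace_le (le_of_nhds_le_nhds fun φ => ?_)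
    refine ((@Metric.nhds_basis_closedEBall (State A) (mkSpace L) φ).ge_iff).mpr fun ε hε => ?_
    exact h φ ε hε

end StateLemmas

/-! ### Admissible Lip-norms on a direct sum -/

section DirectSum

variable {A B : Type u} [CStarAlgebra A] [CStarAlgebra B]

/-- The first component of a self-adjoint element of `A ⊕ B`. -/
def saFst (x : selfAdjoint (A × B)) : selfAdjoint A :=
  ⟨(x : A × B).1, congrArg Prod.fst x.2⟩

/-- The second component of a self-adjoint element of `A ⊕ B`. -/
def saSnd (x : selfAdjoint (A × B)) : selfAdjoint B :=
  ⟨(x : A × B).2, congrArg Prod.snd x.2⟩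

theorem saPair_fst_snd (x : selfAdjoint (A × B)) : saPair (saFst x) (saSnd x) = x := rfl

theorem saFst_add (x y : selfAdjoint (A × B)) : saFst (x + y) = saFst x + saFst y := rfl

theorem saSnd_add (x y : selfAdjoint (A × B)) : saSnd (x + y) = saSnd x + saSnd y := rfl

theorem saFst_smul (r : ℝ) (x : selfAdjoint (A × B)) : saFst (r • x) = r • saFst x := rfl

theorem saSnd_smul (r : ℝ) (x : selfAdjoint (A × B)) : saSnd (r • x) = r • saSnd x := rfl

theorem saPair_add (a a' : selfAdjoint A) (b b' : selfAdjoint B) :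
    saPair a b + saPair a' b' = saPair (a + a') (b + b') := rfl

theorem smul_saPair (r : ℝ) (a : selfAdjoint A) (b : selfAdjoint B) :
    r • saPair a b = saPair (r • a) (r • b) := rfl

theorem continuous_saPair :
    Continuous fun p : selfAdjoint A × selfAdjoint B => saPair p.1 p.2 :=
  ((continuous_subtype_val.comp continuous_fst).prodMk
    (continuous_subtype_val.comp continuous_snd)).subtype_mk _

theorem dense_of_dense_prod {S : Set (selfAdjoint A)} {T : Set (selfAdjoint B)} (hS : Dense S)
    (hT : Dense T) : Dense {x : selfAdjoint (A × B) | saFst x ∈ S ∧ saSnd x ∈ T} := by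
  have hr : Function.Surjective fun p : selfAdjoint A × selfAdjoint B => saPair p.1 p.2 :=
    fun x => ⟨(saFst x, saSnd x), rfl⟩
  refine (hr.denseRange.dense_image continuous_saPair (hS.prod hT)).mono ?_
  rintro _ ⟨p, hp, rfl⟩
  exact hp

/-- The first marginal of a state of `A ⊕ B`, completed to a state by a multiple of `φ₀`. -/
def State.marginalFst (φ₀ : State A) (χ : State (A × B)) : State A :=
  ⟨StrongDual.toWeakDual
      ((WeakDual.toStrongDual χ.1).comp (ContinuousLinearMap.inl ℂ A B) +
        χ.1 (0, 1) • WeakDual.toStrongDual φ₀.1),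
    fun a => by
      have h := χ.2.1 (a, 0)
      have h' := χ.2.1 (0, 1)
      simp only [Prod.star_def, Prod.mk_mul_mk, star_zero, star_one, mul_zero, mul_one] at h h'
      exact add_nonneg h (mul_nonneg h' (φ₀.2.1 a)),
    by
      have h : χ.1 (1, 0) + χ.1 (0, 1) * φ₀.1 1 = 1 := by
        rw [φ₀.2.2, mul_one, ← map_add, Prod.mk_add_mk, add_zero, zero_add]
        exact χ.2.2
      exact h⟩

theorem State.marginalFst_apply (φ₀ : State A) (χ : State (A × B)) (a : A) :
    (State.marginalFst φ₀ χ).1 a = χ.1 (a, 0) + χ.1 (0, 1) * φ₀.1 a := rfl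

theorem State.continuous_marginalFst (φ₀ : State A) :
    Continuous (State.marginalFst (B := B) φ₀) :=
  State.continuous_iff.mpr fun a =>
    ((WeakDual.eval_continuous (a, (0 : B))).comp continuous_subtype_val).add
      (((WeakDual.eval_continuous ((0 : A), (1 : B))).comp continuous_subtype_val).mul_const _)

/-- The second marginal of a state of `A ⊕ B`, completed to a state by a multiple of `ψ₀`. -/
def State.marginalSnd (ψ₀ : State B) (χ : State (A × B)) : State B :=
  ⟨StrongDual.toWeakDual
      ((WeakDual.toStrongDual χ.1).comp (ContinuousLinearMap.inr ℂ A B) +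
        χ.1 (1, 0) • WeakDual.toStrongDual ψ₀.1),
    fun b => by
      have h := χ.2.1 (0, b)
      have h' := χ.2.1 (1, 0)
      simp only [Prod.star_def, Prod.mk_mul_mk, star_zero, star_one, mul_zero, mul_one] at h h'
      exact add_nonneg h (mul_nonneg h' (ψ₀.2.1 b)),
    by
      have h : χ.1 (0, 1) + χ.1 (1, 0) * ψ₀.1 1 = 1 := by
        rw [ψ₀.2.2, mul_one, ← map_add, Prod.mk_add_mk, add_zero, zero_add]
        exact χ.2.2
      exact h⟩

theorem State.marginalSnd_apply (ψ₀ : State B) (χ : State (A × B)) (b : B) :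
    (State.marginalSnd ψ₀ χ).1 b = χ.1 (0, b) + χ.1 (1, 0) * ψ₀.1 b := rfl

theorem State.continuous_marginalSnd (ψ₀ : State B) :
    Continuous (State.marginalSnd (A := A) ψ₀) :=
  State.continuous_iff.mpr fun b =>
    ((WeakDual.eval_continuous ((0 : A), b)).comp continuous_subtype_val).add
      (((WeakDual.eval_continuous ((1 : A), (0 : B))).comp continuous_subtype_val).mul_const _)

/-- Because `χ(1,0) = 1 - χ(0,1)`, the two corrections that complete the marginals combine into one
multiple of `φ₀(a) - ψ₀(b)`, the quantity an admissible seminorm controls. -/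
theorem State.edist_apply_le_marginals (φ₀ : State A) (ψ₀ : State B) (χ χ' : State (A × B))
    (a : A) (b : B) :
    edist (χ.1 (a, b)) (χ'.1 (a, b)) ≤
      edist ((State.marginalFst φ₀ χ).1 a) ((State.marginalFst φ₀ χ').1 a) +
        edist ((State.marginalSnd ψ₀ χ).1 b) ((State.marginalSnd ψ₀ χ').1 b) +
        edist (χ.1 (0, 1)) (χ'.1 (0, 1)) * edist (φ₀.1 a) (ψ₀.1 b) := by
  have hsplit (θ : State (A × B)) : θ.1 (a, b) = θ.1 (a, 0) + θ.1 (0, b) := by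
    rw [← map_add, Prod.mk_add_mk, add_zero, zero_add]
  have hone (θ : State (A × B)) : θ.1 (1, 0) = 1 - θ.1 (0, 1) := by
    rw [eq_sub_iff_add_eq, ← map_add, Prod.mk_add_mk, add_zero, zero_add]
    exact θ.2.2
  simp only [edist_eq_enorm_sub, ← enorm_mul]
  have : χ.1 (a, b) - χ'.1 (a, b) =
      ((State.marginalFst φ₀ χ).1 a - (State.marginalFst φ₀ χ').1 a) +
        ((State.marginalSnd ψ₀ χ).1 b - (State.marginalSnd ψ₀ χ').1 b) -
        (χ.1 (0, 1) - χ'.1 (0, 1)) * (φ₀.1 a - ψ₀.1 b) := by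
    simp only [State.marginalFst_apply, State.marginalSnd_apply, hsplit, hone]
    ring
  rw [this]
  refine (enorm_sub_le).trans ?_
  gcongr
  exact enorm_add_le _ _

/-- A seminorm on `A ⊕ B` with the right domain and quotients is an admissible Lip-norm as soon
as it puts one state of `A` at a finite distance of one state of `B`. -/
theorem isAdmissible_of_edist_le_mul {LA : selfAdjoint A → ℝ≥0∞} {LB : selfAdjoint B → ℝ≥0∞}
    (hA : IsLipNorm LA) (hB : IsLipNorm LB) {L : selfAdjoint (A × B) → ℝ≥0∞}
    (add_le : ∀ x y, L (x + y) ≤ L x + L y)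
    (smul_eq : ∀ (r : ℝ) (x), L (r • x) = ‖r‖ₑ * L x)
    (one_eq : L 1 = 0)
    (dom_eq : ∀ a b, L (saPair a b) < ∞ ↔ LA a < ∞ ∧ LB b < ∞)
    (quotient_left : ∀ a, LA a = ⨅ b, L (saPair a b))
    (quotient_right : ∀ b, LB b = ⨅ a, L (saPair a b))
    {φ₀ : State A} {ψ₀ : State B} {K : ℝ≥0∞} (hK : K ≠ ∞)
    (hle : ∀ (a : selfAdjoint A) (b : selfAdjoint B), edist (φ₀.1 (a : A)) (ψ₀.1 (b : B)) ≤ K * L (saPair a b)) :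
    IsAdmissible LA LB L := by
  have hleA (x : selfAdjoint (A × B)) : LA (saFst x) ≤ L x :=
    (quotient_left _).trans_le (iInf_le _ (saSnd x))
  have hleB (x : selfAdjoint (A × B)) : LB (saSnd x) ≤ L x :=
    (quotient_right _).trans_le (iInf_le _ (saFst x))
  have hpair : IsLipschitzPair L :=
    { add_le := add_le
      smul_eq := smul_eq
      dense_dom := (dense_of_dense_prod hA.dense_dom hB.dense_dom).mono
        fun x hx => (dom_eq (saFst x) (saSnd x)).mpr hx
      eq_zero_iff := fun x => by
        constructor
        · intro hx
          obtain ⟨s, hs⟩ := (hA.eq_zero_iff _).mp (le_antisymm ((hleA x).trans_eq hx) zero_le)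
          obtain ⟨t, ht⟩ := (hB.eq_zero_iff _).mp (le_antisymm ((hleB x).trans_eq hx) zero_le)
          have h := hle (saFst x) (saSnd x)
          have hφ : φ₀.1 ((1 : selfAdjoint A) : A) = 1 := φ₀.2.2
          have hψ : ψ₀.1 ((1 : selfAdjoint B) : B) = 1 := ψ₀.2.2
          -- At `L x = 0` the bound `hle` vanishes and forces the scalars `s` and `t` to agree.
          rw [saPair_fst_snd, hx, mul_zero, hs, ht, State.apply_real_smul,
            State.apply_real_smul, hφ, hψ, mul_one, mul_one, nonpos_iff_eq_zero,
            edist_eq_zero, Complex.ofReal_inj] at h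
          refine ⟨s, ?_⟩
          rw [← saPair_fst_snd x, hs, ht, ← h]
          rfl
        · rintro ⟨r, rfl⟩
          rw [smul_eq, one_eq, mul_zero] }
  refine ⟨hpair.isLipNorm_of_eventually fun χ ε hε => ?_, dom_eq, quotient_left, quotient_right⟩
  have hε' : 0 < ε / 3 := ENNReal.div_pos hε.ne' (by norm_num)
  -- For `L x ≤ 1` the gap between `φ₀` and `ψ₀` is at most `K`, so the mass `χ(0,1)` may vary by
  -- `δ` with `δ * K < ε / 3`.
  obtain ⟨δ, hδ, hδK⟩ := ENNReal.exists_nnreal_pos_mul_lt hK hε'.ne'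
  have hδ' : (0 : ℝ≥0∞) < δ := by exact_mod_cast hδ
  have h1 : ∀ᶠ χ' in 𝓝 χ, mkDist LA (State.marginalFst φ₀ χ') (State.marginalFst φ₀ χ) < ε / 3 :=
    (State.continuous_marginalFst φ₀).continuousAt.eventually (hA.eventually_mkDist_lt _ hε')
  have h2 : ∀ᶠ χ' in 𝓝 χ, mkDist LB (State.marginalSnd ψ₀ χ') (State.marginalSnd ψ₀ χ) < ε / 3 :=
    (State.continuous_marginalSnd ψ₀).continuousAt.eventually (hB.eventually_mkDist_lt _ hε')
  have h3 : ∀ᶠ χ' in 𝓝 χ, edist (χ'.1 ((0, 1) : A × B)) (χ.1 (0, 1)) < δ :=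
    ((WeakDual.eval_continuous ((0, 1) : A × B)).comp continuous_subtype_val).continuousAt
      (Metric.eball_mem_nhds _ hδ')
  filter_upwards [h1, h2, h3] with χ' h1 h2 h3
  refine iSup₂_le fun x hx => ?_
  calc _ ≤ _ := State.edist_apply_le_marginals φ₀ ψ₀ χ' χ (saFst x) (saSnd x)
    _ ≤ ε / 3 + ε / 3 + ε / 3 := by
      refine add_le_add (add_le_add ?_ ?_) ?_
      · exact (edist_le_mkDist ((hleA x).trans hx) _ _).trans h1.le
      · exact (edist_le_mkDist ((hleB x).trans hx) _ _).trans h2.le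
      · refine (mul_le_mul' h3.le ?_).trans hδK.le
        exact (hle _ _).trans (mul_le_of_le_one_right' hx)
    _ = ε := ENNReal.add_thirds ε

end DirectSum

/-! ### Composition of admissible Lip-norms and the triangle inequality -/

section Composition

variable {A B C : Type u} [CStarAlgebra A] [CStarAlgebra B] [CStarAlgebra C]

theorem mkDist_fst_snd_le {L : selfAdjoint (A × B) → ℝ≥0∞} {φ : State A} {ψ : State B} {M : ℝ≥0∞}
    (h : ∀ (a : selfAdjoint A) (b : selfAdjoint B),
      edist (φ.1 (a : A)) (ψ.1 (b : B)) ≤ M * L (saPair a b)) :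
    mkDist L (State.comap (StarAlgHom.fst ℂ A B) φ) (State.comap (StarAlgHom.snd ℂ A B) ψ) ≤ M :=
  mkDist_le_of_edist_le_mul fun x => h (saFst x) (saSnd x)

theorem IsAdmissible.one_eq {LA : selfAdjoint A → ℝ≥0∞} {LB : selfAdjoint B → ℝ≥0∞}
    {L : selfAdjoint (A × B) → ℝ≥0∞} (hL : IsAdmissible LA LB L) : L (saPair 1 1) = 0 :=
  (hL.isLipNorm.eq_zero_iff _).mpr ⟨1, (one_smul ℝ _).symm⟩

theorem IsAdmissible.left_le {LA : selfAdjoint A → ℝ≥0∞} {LB : selfAdjoint B → ℝ≥0∞}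
    {L : selfAdjoint (A × B) → ℝ≥0∞} (hL : IsAdmissible LA LB L) (a : selfAdjoint A)
    (b : selfAdjoint B) : LA a ≤ L (saPair a b) :=
  (hL.quotient_left a).trans_le (iInf_le _ b)

theorem IsAdmissible.right_le {LA : selfAdjoint A → ℝ≥0∞} {LB : selfAdjoint B → ℝ≥0∞}
    {L : selfAdjoint (A × B) → ℝ≥0∞} (hL : IsAdmissible LA LB L) (a : selfAdjoint A)
    (b : selfAdjoint B) : LB b ≤ L (saPair a b) :=
  (hL.quotient_right b).trans_le (iInf_le _ a)

theorem IsAdmissible.edist_le_mul {LA : selfAdjoint A → ℝ≥0∞} {LB : selfAdjoint B → ℝ≥0∞}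
    {L : selfAdjoint (A × B) → ℝ≥0∞} (hL : IsAdmissible LA LB L) {φ : State A} {ψ : State B}
    {M : ℝ≥0∞} (hM : mkDist L (State.comap (StarAlgHom.fst ℂ A B) φ)
      (State.comap (StarAlgHom.snd ℂ A B) ψ) < M) (a : selfAdjoint A) (b : selfAdjoint B) :
    edist (φ.1 (a : A)) (ψ.1 (b : B)) ≤ M * L (saPair a b) :=
  hL.isLipNorm.toIsLipschitzPair.edist_le_mul hM (saPair a b)

/-- The composition of seminorms on `A ⊕ B` and on `B ⊕ C`, a seminorm on `A ⊕ C`. -/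
def compLip (L₁ : selfAdjoint (A × B) → ℝ≥0∞) (L₂ : selfAdjoint (B × C) → ℝ≥0∞)
    (x : selfAdjoint (A × C)) : ℝ≥0∞ :=
  ⨅ b, max (L₁ (saPair (saFst x) b)) (L₂ (saPair b (saSnd x)))

theorem compLip_saPair (L₁ : selfAdjoint (A × B) → ℝ≥0∞) (L₂ : selfAdjoint (B × C) → ℝ≥0∞)
    (a : selfAdjoint A) (c : selfAdjoint C) :
    compLip L₁ L₂ (saPair a c) = ⨅ b, max (L₁ (saPair a b)) (L₂ (saPair b c)) := rfl

/-- For each intermediate `b`, one passes through `χ(b)`; the constants add. Bounds at every pair,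
rather than on unit balls, allow the same `b` in both halves. -/
theorem edist_le_mul_compLip {L₁ : selfAdjoint (A × B) → ℝ≥0∞} {L₂ : selfAdjoint (B × C) → ℝ≥0∞}
    {φ : State A} {χ : State B} {ψ : State C} {M₁ M₂ : ℝ≥0∞} (hM₁ : M₁ ≠ ∞) (hM₂ : M₂ ≠ ∞)
    (h₁ : ∀ (a : selfAdjoint A) (b : selfAdjoint B),
      edist (φ.1 (a : A)) (χ.1 (b : B)) ≤ M₁ * L₁ (saPair a b))
    (h₂ : ∀ (b : selfAdjoint B) (c : selfAdjoint C),
      edist (χ.1 (b : B)) (ψ.1 (c : C)) ≤ M₂ * L₂ (saPair b c))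
    (a : selfAdjoint A) (c : selfAdjoint C) :
    edist (φ.1 (a : A)) (ψ.1 (c : C)) ≤ (M₁ + M₂) * compLip L₁ L₂ (saPair a c) := by
  rw [compLip_saPair, ENNReal.mul_iInf (fun h => absurd h (ENNReal.add_ne_top.mpr ⟨hM₁, hM₂⟩))]
  refine le_iInf fun b => (edist_triangle _ (χ.1 (b : B)) _).trans ?_
  rw [add_mul]
  exact add_le_add ((h₁ a b).trans (mul_le_mul_right (le_max_left _ _) _))
    ((h₂ b c).trans (mul_le_mul_right (le_max_right _ _) _))

theorem IsAdmissible.comp {LA : selfAdjoint A → ℝ≥0∞} {LB : selfAdjoint B → ℝ≥0∞}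
    {LC : selfAdjoint C → ℝ≥0∞} (hA : IsLipNorm LA) (hC : IsLipNorm LC)
    {L₁ : selfAdjoint (A × B) → ℝ≥0∞} {L₂ : selfAdjoint (B × C) → ℝ≥0∞}
    (hL₁ : IsAdmissible LA LB L₁) (hL₂ : IsAdmissible LB LC L₂)
    {φ₀ : State A} {ψ₀ : State C} {K : ℝ≥0∞} (hK : K ≠ ∞)
    (hle : ∀ (a : selfAdjoint A) (c : selfAdjoint C),
      edist (φ₀.1 (a : A)) (ψ₀.1 (c : C)) ≤ K * compLip L₁ L₂ (saPair a c)) :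
    IsAdmissible LA LC (compLip L₁ L₂) := by
  refine isAdmissible_of_edist_le_mul hA hC (fun x y => ?_) (fun r x => ?_) ?_ (fun a c => ?_)
    (fun a => ?_) (fun c => ?_) hK hle
  · simp only [compLip, ENNReal.iInf_add, ENNReal.add_iInf]
    refine le_iInf₂ fun b' b => (iInf_le _ (b + b')).trans (max_le ?_ ?_)
    · rw [saFst_add, ← saPair_add]
      exact (hL₁.isLipNorm.add_le _ _).trans
        (add_le_add (le_max_left _ _) (le_max_left _ _))
    · rw [saSnd_add, ← saPair_add]
      exact (hL₂.isLipNorm.add_le _ _).trans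
        (add_le_add (le_max_right _ _) (le_max_right _ _))
  · rcases eq_or_ne r 0 with rfl | hr
    · rw [enorm_zero, zero_mul, zero_smul]
      refine le_antisymm ((iInf_le _ 0).trans (max_le ?_ ?_)) zero_le
      · exact ((hL₁.isLipNorm.eq_zero_iff 0).mpr ⟨0, (zero_smul ℝ _).symm⟩).le
      · exact ((hL₂.isLipNorm.eq_zero_iff 0).mpr ⟨0, (zero_smul ℝ _).symm⟩).le
    · rw [compLip, compLip, ENNReal.mul_iInf (fun h => absurd h enorm_ne_top)]
      have hs : Function.Surjective fun b : selfAdjoint B => r • b :=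
        fun b => ⟨r⁻¹ • b, smul_inv_smul₀ hr b⟩
      refine (hs.iInf_congr _ fun b => ?_).symm
      rw [saFst_smul, saSnd_smul, ← smul_saPair, ← smul_saPair, hL₁.isLipNorm.smul_eq,
        hL₂.isLipNorm.smul_eq, mul_max]
  · exact le_antisymm ((iInf_le _ 1).trans (max_le hL₁.one_eq.le hL₂.one_eq.le)) zero_le
  · rw [compLip_saPair, iInf_lt_top]
    constructor
    · rintro ⟨b, hb⟩
      have hb := max_lt_iff.mp hb
      exact ⟨((hL₁.dom_eq _ _).mp hb.1).1, ((hL₂.dom_eq _ _).mp hb.2).2⟩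
    -- The intermediate element `0` works, once `LB 0` is known to be finite.
    · rintro ⟨ha, hc⟩
      have h0 : LB 0 < ∞ := by
        refine (hL₁.right_le 0 0).trans_lt ?_
        rw [(hL₁.isLipNorm.eq_zero_iff (saPair 0 0)).mpr ⟨0, (zero_smul ℝ _).symm⟩]
        exact ENNReal.zero_lt_top
      exact ⟨0, max_lt ((hL₁.dom_eq _ _).mpr ⟨ha, h0⟩) ((hL₂.dom_eq _ _).mpr ⟨h0, hc⟩)⟩
  · simp only [compLip_saPair]
    -- After exchanging the infima, the one over `c` replaces `L₂(b,c)` by `LB b`, which `L₁(a,b)`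
    -- already dominates.
    rw [iInf_comm, hL₁.quotient_left]
    refine iInf_congr fun b => ?_
    rw [← sup_iInf_eq, ← hL₂.quotient_left, max_eq_left (hL₁.right_le a b)]
  · simp only [compLip_saPair]
    rw [iInf_comm, hL₂.quotient_right]
    refine iInf_congr fun b => ?_
    rw [← iInf_sup_eq, ← hL₁.quotient_right, max_eq_right (hL₂.left_le b c)]

end Composition

theorem exists_isAdmissible_of_distQ_lt {X Y : QCMS.{u}} {r : ℝ≥0∞} (h : distQ X Y < r) :
    ∃ L, IsAdmissible X.lip Y.lip L ∧
      mkHausdorff L (Set.range (State.comap (StarAlgHom.fst ℂ X Y)))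
        (Set.range (State.comap (StarAlgHom.snd ℂ X Y))) < r := by
  obtain ⟨L, hL⟩ := iInf_lt_iff.mp h
  obtain ⟨hadm, hlt⟩ := iInf_lt_iff.mp hL
  exact ⟨L, hadm, hlt⟩

/-- The triangle inequality for Rieffel's distance. -/
theorem distQ_triangle (X Y Z : QCMS.{u}) [Nonempty (State X)] :
    distQ X Z ≤ distQ X Y + distQ Y Z := by
  obtain ⟨φ₀⟩ := ‹Nonempty (State X)›
  refine ENNReal.le_of_forall_pos_le_add fun ε hε hfin => ?_
  obtain ⟨hXY, hYZ⟩ := ENNReal.add_lt_top.mp hfin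
  have hε2 : (ε / 2 : ℝ≥0∞) ≠ 0 := by simpa using hε.ne'
  obtain ⟨L₁, hL₁, h₁⟩ := exists_isAdmissible_of_distQ_lt (ENNReal.lt_add_right hXY.ne hε2)
  obtain ⟨L₂, hL₂, h₂⟩ := exists_isAdmissible_of_distQ_lt (ENNReal.lt_add_right hYZ.ne hε2)
  set r₁ := distQ X Y + ε / 2
  set r₂ := distQ Y Z + ε / 2
  have hε2' : (ε / 2 : ℝ≥0∞) ≠ ∞ := ENNReal.div_ne_top ENNReal.coe_ne_top two_ne_zero
  have hr₁ : r₁ ≠ ∞ := ENNReal.add_ne_top.mpr ⟨hXY.ne, hε2'⟩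
  have hr₂ : r₂ ≠ ∞ := ENNReal.add_ne_top.mpr ⟨hYZ.ne, hε2'⟩
  have hr : r₁ + r₂ = distQ X Y + distQ Y Z + ε := by
    rw [add_add_add_comm, ENNReal.add_halves]
  have hfwd (φ : State X) : ∃ ψ : State Z, ∀ (a : selfAdjoint X) (c : selfAdjoint Z),
      edist (φ.1 (a : X)) (ψ.1 (c : Z)) ≤ (r₁ + r₂) * compLip L₁ L₂ (saPair a c) := by
    obtain ⟨_, ⟨χ, rfl⟩, hχ⟩ := exists_mkDist_lt_of_mkHausdorff_lt h₁ ⟨φ, rfl⟩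
    obtain ⟨_, ⟨ψ, rfl⟩, hψ⟩ := exists_mkDist_lt_of_mkHausdorff_lt h₂ ⟨χ, rfl⟩
    exact ⟨ψ, edist_le_mul_compLip hr₁ hr₂ (hL₁.edist_le_mul hχ) (hL₂.edist_le_mul hψ)⟩
  have hbwd (ψ : State Z) : ∃ φ : State X, ∀ (a : selfAdjoint X) (c : selfAdjoint Z),
      edist (φ.1 (a : X)) (ψ.1 (c : Z)) ≤ (r₁ + r₂) * compLip L₁ L₂ (saPair a c) := by
    rw [mkHausdorff_comm] at h₁ h₂
    obtain ⟨_, ⟨χ, rfl⟩, hχ⟩ := exists_mkDist_lt_of_mkHausdorff_lt h₂ ⟨ψ, rfl⟩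
    obtain ⟨_, ⟨φ, rfl⟩, hφ⟩ := exists_mkDist_lt_of_mkHausdorff_lt h₁ ⟨χ, rfl⟩
    rw [mkDist_comm] at hχ hφ
    exact ⟨φ, edist_le_mul_compLip hr₁ hr₂ (hL₁.edist_le_mul hφ) (hL₂.edist_le_mul hχ)⟩
  -- One pair of states at finite distance is enough for admissibility; it exists because `X` has a
  -- state.
  obtain ⟨ψ₀, h₀⟩ := hfwd φ₀
  have hadm := IsAdmissible.comp X.isLipNorm Z.isLipNorm hL₁ hL₂
    (ENNReal.add_ne_top.mpr ⟨hr₁, hr₂⟩) h₀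
  rw [← hr]
  refine (iInf₂_le (compLip L₁ L₂) hadm).trans (mkHausdorff_le_of_mkDist_le ?_ ?_)
  · rintro _ ⟨φ, rfl⟩
    obtain ⟨ψ, h⟩ := hfwd φ
    exact ⟨_, ⟨ψ, rfl⟩, mkDist_fst_snd_le h⟩
  · rintro _ ⟨ψ, rfl⟩
    obtain ⟨φ, h⟩ := hbwd ψ
    exact ⟨_, ⟨φ, rfl⟩, (mkDist_comm _ _ _).trans_le (mkDist_fst_snd_le h)⟩

/-! ### The Lip-norm of a bridge -/

section BridgeLip

variable {X Y : QCMS.{u}}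

/-- The seminorm on the direct sum defined by a bridge and a weight. -/
def Bridge.lip (γ : Bridge X Y) (r : ℝ≥0∞) (x : selfAdjoint (X × Y)) : ℝ≥0∞ :=
  max (max (X.lip (saFst x)) (Y.lip (saSnd x)))
    (r⁻¹ * edist (γ.left (saFst x : X) * γ.pivot) (γ.pivot * γ.right (saSnd x : Y)))

theorem Bridge.lip_saPair (γ : Bridge X Y) (r : ℝ≥0∞) (a : selfAdjoint X) (b : selfAdjoint Y) :
    γ.lip r (saPair a b) = max (max (X.lip a) (Y.lip b))
      (r⁻¹ * edist (γ.left (a : X) * γ.pivot) (γ.pivot * γ.right (b : Y))) := rfl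

theorem Bridge.edist_smul (γ : Bridge X Y) (r : ℝ) (a : selfAdjoint X) (b : selfAdjoint Y) :
    edist (γ.left ((r • a : selfAdjoint X) : X) * γ.pivot)
      (γ.pivot * γ.right ((r • b : selfAdjoint Y) : Y)) =
    ‖r‖ₑ * edist (γ.left (a : X) * γ.pivot) (γ.pivot * γ.right (b : Y)) := by
  rw [selfAdjoint.val_smul, selfAdjoint.val_smul, ← Complex.coe_smul, ← Complex.coe_smul,
    map_smul, map_smul, smul_mul_assoc, mul_smul_comm, edist_smul₀, ENNReal.smul_def, smul_eq_mul]
  simp [enorm_eq_nnnorm]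

/-- After scaling to `L(a) = 1`, the reach supplies a partner in the other unit ball at distance
below `r`, and scaling back gives `b`. A scalar, which cannot be normalised, is paired with the same
scalar. -/
theorem Bridge.exists_lip_le_left (γ : Bridge X Y) {r : ℝ≥0∞} (hr : γ.reach < r)
    (hr' : r ≠ ∞) (a : selfAdjoint X) :
    ∃ b, γ.lip r (saPair a b) ≤ X.lip a := by
  by_cases ht : X.lip a = ∞
  · exact ⟨0, ht ▸ le_top⟩
  by_cases h0 : X.lip a = 0
  · obtain ⟨s, rfl⟩ := (X.isLipNorm.eq_zero_iff a).mp h0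
    refine ⟨s • 1, ?_⟩
    have h1 : Y.lip (s • 1) = 0 := (Y.isLipNorm.eq_zero_iff _).mpr ⟨s, rfl⟩
    rw [γ.lip_saPair, γ.edist_smul, h0, h1, selfAdjoint.val_one, selfAdjoint.val_one, map_one,
      map_one, one_mul, mul_one, edist_self, mul_zero, mul_zero, max_self, max_self]
  obtain ⟨s, hs, hse, h1⟩ := exists_real_smul_eq_one X.isLipNorm.smul_eq h0 ht
  obtain ⟨_, ⟨b, hb, rfl⟩, hab⟩ := Metric.exists_edist_lt_of_hausdorffEDist_lt
    (Set.mem_image_of_mem _ (show s • a ∈ {x | X.lip x ≤ 1} from h1.le)) hr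
  refine ⟨s⁻¹ • b, ?_⟩
  have hsi : ‖s⁻¹‖ₑ = X.lip a := by rw [enorm_inv hs, hse, inv_inv]
  have ha : a = s⁻¹ • s • a := (inv_smul_smul₀ hs a).symm
  rw [γ.lip_saPair]
  refine max_le (max_le le_rfl ?_) ?_
  · rw [Y.isLipNorm.smul_eq, hsi]
    exact mul_le_of_le_one_right' hb
  · rw [ha, γ.edist_smul, hsi, mul_left_comm, ← ha]
    refine mul_le_of_le_one_right' ?_
    rw [← ENNReal.inv_mul_cancel (pos_of_gt hr).ne' hr']
    exact mul_le_mul_right hab.le _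

theorem Bridge.exists_lip_le_right (γ : Bridge X Y) {r : ℝ≥0∞} (hr : γ.reach < r)
    (hr' : r ≠ ∞) (b : selfAdjoint Y) :
    ∃ a, γ.lip r (saPair a b) ≤ Y.lip b := by
  by_cases ht : Y.lip b = ∞
  · exact ⟨0, ht ▸ le_top⟩
  by_cases h0 : Y.lip b = 0
  · obtain ⟨s, rfl⟩ := (Y.isLipNorm.eq_zero_iff b).mp h0
    refine ⟨s • 1, ?_⟩
    have h1 : X.lip (s • 1) = 0 := (X.isLipNorm.eq_zero_iff _).mpr ⟨s, rfl⟩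
    rw [γ.lip_saPair, γ.edist_smul, h0, h1, selfAdjoint.val_one, selfAdjoint.val_one, map_one,
      map_one, one_mul, mul_one, edist_self, mul_zero, mul_zero, max_self, max_self]
  obtain ⟨s, hs, hse, h1⟩ := exists_real_smul_eq_one Y.isLipNorm.smul_eq h0 ht
  rw [Bridge.reach, Metric.hausdorffEDist_comm] at hr
  obtain ⟨_, ⟨a, ha, rfl⟩, hab⟩ := Metric.exists_edist_lt_of_hausdorffEDist_lt
    (Set.mem_image_of_mem _ (show s • b ∈ {x | Y.lip x ≤ 1} from h1.le)) hr
  refine ⟨s⁻¹ • a, ?_⟩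
  have hsi : ‖s⁻¹‖ₑ = Y.lip b := by rw [enorm_inv hs, hse, inv_inv]
  have hb : b = s⁻¹ • s • b := (inv_smul_smul₀ hs b).symm
  rw [γ.lip_saPair]
  refine max_le (max_le ?_ le_rfl) ?_
  · rw [X.isLipNorm.smul_eq, hsi]
    exact mul_le_of_le_one_right' ha
  · rw [hb, γ.edist_smul, hsi, mul_left_comm, ← hb]
    refine mul_le_of_le_one_right' ?_
    rw [← ENNReal.inv_mul_cancel (pos_of_gt hr).ne' hr', edist_comm]
    exact mul_le_mul_right hab.le _

theorem Bridge.edist_oneLevel_le (γ : Bridge X Y) {r : ℝ≥0∞} (h0 : r ≠ 0) (hr : r ≠ ∞)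
    {θ : State γ.D} (hθ : θ ∈ oneLevel γ.pivot) (a : selfAdjoint X) (b : selfAdjoint Y) :
    edist ((State.comap γ.left θ).1 (a : X)) ((State.comap γ.right θ).1 (b : Y)) ≤
      r * γ.lip r (saPair a b) := by
  rw [State.comap_apply, State.comap_apply, ← State.apply_mul_of_mem_oneLevel hθ (γ.left a),
    ← State.mul_apply_of_mem_oneLevel hθ (γ.right b)]
  refine (θ.edist_apply_le _ _).trans ?_
  calc _ = r * (r⁻¹ * edist (γ.left (a : X) * γ.pivot) (γ.pivot * γ.right (b : Y))) := by
        rw [← mul_assoc, ENNReal.mul_inv_cancel h0 hr, one_mul]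
    _ ≤ _ := mul_le_mul_right (le_max_right _ _) _

/-- Only the reach matters for the quotients. The pair of states at finite distance comes from
restricting any state of the 1-level. -/
theorem Bridge.isAdmissible_lip (γ : Bridge X Y) {r : ℝ≥0∞} (hr : γ.reach < r) (hr' : r ≠ ∞) :
    IsAdmissible X.lip Y.lip (γ.lip r) := by
  have h0 : r ≠ 0 := (pos_of_gt hr).ne'
  have hinv : r⁻¹ ≠ ∞ := ENNReal.inv_ne_top.mpr h0
  obtain ⟨θ, hθ⟩ := γ.oneLevel_nonempty
  refine isAdmissible_of_edist_le_mul X.isLipNorm Y.isLipNorm (fun x y => ?_) (fun s x => ?_) ?_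
    (fun a b => ?_) (fun a => ?_) (fun b => ?_) hr' (γ.edist_oneLevel_le h0 hr' hθ)
  · refine max_le (max_le ?_ ?_) ?_
    · exact (X.isLipNorm.add_le _ _).trans (add_le_add
        ((le_max_left _ _).trans (le_max_left _ _)) ((le_max_left _ _).trans (le_max_left _ _)))
    · exact (Y.isLipNorm.add_le _ _).trans (add_le_add
        ((le_max_right _ _).trans (le_max_left _ _)) ((le_max_right _ _).trans (le_max_left _ _)))
    · refine le_trans ?_ (add_le_add (le_max_right _ _) (le_max_right _ _))
      rw [← mul_add, saFst_add, saSnd_add, AddSubgroup.coe_add, AddSubgroup.coe_add, map_add,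
        map_add, add_mul, mul_add]
      exact mul_le_mul_right (edist_add_add_le _ _ _ _) _
  · rw [Bridge.lip, Bridge.lip, saFst_smul, saSnd_smul, γ.edist_smul, X.isLipNorm.smul_eq,
      Y.isLipNorm.smul_eq, mul_max, mul_max, mul_left_comm]
  · have hX : X.lip 1 = 0 := (X.isLipNorm.eq_zero_iff 1).mpr ⟨1, (one_smul ℝ _).symm⟩
    have hY : Y.lip 1 = 0 := (Y.isLipNorm.eq_zero_iff 1).mpr ⟨1, (one_smul ℝ _).symm⟩
    change γ.lip r (saPair 1 1) = 0
    rw [γ.lip_saPair, hX, hY, selfAdjoint.val_one, selfAdjoint.val_one, map_one,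
      map_one, one_mul, mul_one, edist_self, mul_zero, max_self, max_self]
  · rw [γ.lip_saPair, max_lt_iff, max_lt_iff, and_iff_left]
    exact (ENNReal.mul_ne_top hinv (edist_ne_top _ _)).lt_top
  · refine le_antisymm (le_iInf fun b => (le_max_left _ _).trans (le_max_left _ _)) ?_
    obtain ⟨b, hb⟩ := γ.exists_lip_le_left hr hr' a
    exact (iInf_le _ b).trans hb
  · refine le_antisymm (le_iInf fun a => (le_max_right _ _).trans (le_max_left _ _)) ?_
    obtain ⟨a, ha⟩ := γ.exists_lip_le_right hr hr' b
    exact (iInf_le _ a).trans ha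

theorem Bridge.distQ_le (γ : Bridge X Y) : distQ X Y ≤ 2 * γ.length := by
  refine ENNReal.le_of_forall_pos_le_add fun ε hε hfin => ?_
  have hlen : γ.length ≠ ∞ := fun h => hfin.ne (by rw [h, ENNReal.mul_top two_ne_zero])
  have hε2 : (ε / 2 : ℝ≥0∞) ≠ 0 := by simpa using hε.ne'
  have hε2' : (ε / 2 : ℝ≥0∞) ≠ ∞ := ENNReal.div_ne_top ENNReal.coe_ne_top two_ne_zero
  set r := γ.length + ε / 2 with hr
  have hlt : γ.length < r := ENNReal.lt_add_right hlen hε2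
  have hr' : r ≠ ∞ := ENNReal.add_ne_top.mpr ⟨hlen, hε2'⟩
  have hrr : 2 * γ.length + ε = r + r := by
    rw [hr, add_add_add_comm, ENNReal.add_halves, two_mul]
  have hreach : γ.reach < r := (le_max_left _ _).trans_lt hlt
  have hleft := ((le_max_left _ _).trans (le_max_right γ.reach _)).trans_lt hlt
  have hright := ((le_max_right _ _).trans (le_max_right γ.reach _)).trans_lt hlt
  have hadm := γ.isAdmissible_lip hreach hr'
  have hmid {θ : State γ.D} (hθ : θ ∈ oneLevel γ.pivot) :=
    γ.edist_oneLevel_le (pos_of_gt hlt).ne' hr' hθ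
  rw [hrr]
  refine (iInf₂_le (γ.lip r) hadm).trans (mkHausdorff_le_of_mkDist_le ?_ ?_)
  · rintro _ ⟨φ, rfl⟩
    obtain ⟨_, ⟨θ, hθ, rfl⟩, h⟩ := exists_mkDist_lt_of_mkHausdorff_lt hleft (Set.mem_univ φ)
    refine ⟨_, ⟨State.comap γ.right θ, rfl⟩, mkDist_fst_snd_le fun a b => ?_⟩
    -- The factor `2` arises here: one `r` from the height, moving `φ` to the restriction of `θ`,
    -- and one from the reach, crossing from `X` to `Y` along `θ`.
    refine (edist_triangle _ ((State.comap γ.left θ).1 (a : X)) _).trans ?_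
    rw [add_mul]
    exact add_le_add ((X.isLipNorm.edist_le_mul h a).trans
      (mul_le_mul_right (hadm.left_le a b) _)) (hmid hθ a b)
  · rintro _ ⟨ψ, rfl⟩
    obtain ⟨_, ⟨θ, hθ, rfl⟩, h⟩ := exists_mkDist_lt_of_mkHausdorff_lt hright (Set.mem_univ ψ)
    rw [mkDist_comm] at h
    refine ⟨_, ⟨State.comap γ.left θ, rfl⟩, (mkDist_comm _ _ _).trans_le
      (mkDist_fst_snd_le fun a b => ?_)⟩
    refine (edist_triangle _ ((State.comap γ.right θ).1 (b : Y)) _).trans ?_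
    rw [add_mul]
    exact add_le_add (hmid hθ a b) ((Y.isLipNorm.edist_le_mul h b).trans
      (mul_le_mul_right (hadm.right_le a b) _))

end BridgeLip

/-! ### From bridges to treks and the propinquity -/

theorem Bridge.nonempty_state {X Y : QCMS.{u}} (γ : Bridge X Y) : Nonempty (State X) :=
  let ⟨θ, _⟩ := γ.oneLevel_nonempty
  ⟨State.comap γ.left θ⟩

theorem Trek.distQ_le {C : Set QCMS.{u}} {X Y : QCMS.{u}} (Γ : Trek C X Y) :
    distQ X Y ≤ 2 * Γ.length := by
  induction Γ with
  | single hX hY γ => exact γ.distQ_le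
  | @cons X Y Z hX γ Γ ih =>
    have := γ.nonempty_state
    rw [Trek.length, mul_add]
    exact (distQ_triangle X Y Z).trans (add_le_add γ.distQ_le ih)

theorem distQ_le_two_mul_propinquity (C : Set QCMS.{u}) (X Y : QCMS.{u}) :
    distQ X Y ≤ 2 * propinquity C X Y := by
  rcases isEmpty_or_nonempty (Trek C X Y) with h | h
  · rw [propinquity, iInf_of_empty, ENNReal.mul_top two_ne_zero]
    exact le_top
  rw [propinquity, ENNReal.mul_iInf (fun h => absurd h ENNReal.ofNat_ne_top)]
  exact le_iInf fun Γ => Γ.distQ_le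

end QuantumMetric
end

theorem mainTheorem4 (C : Set QuantumMetric.QCMS.{u}) (hC : C.Nonempty)
    (hLeibniz : ∀ X ∈ C, X.IsLeibniz) :
    (∀ X ∈ C, ∀ Y ∈ C,
      QuantumMetric.distQ X Y ≤ 2 * QuantumMetric.propinquity C X Y) ∧
    (∀ (ι : Type v) (l : Filter ι) (X : ι → QuantumMetric.QCMS.{u}) (Y : QuantumMetric.QCMS.{u}),
      (∀ i, X i ∈ C) → Y ∈ C →
      Tendsto (fun i => QuantumMetric.propinquity C (X i) Y) l (𝓝 0) →
      Tendsto (fun i => QuantumMetric.distQ (X i) Y) l (𝓝 0)) := by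
  refine ⟨fun X _ Y _ => QuantumMetric.distQ_le_two_mul_propinquity C X Y,
    fun ι l X Y _ _ h => ?_⟩
  have h2 := ENNReal.Tendsto.const_mul (a := 2) h (Or.inr ENNReal.ofNat_ne_top)
  rw [mul_zero] at h2
  exact tendsto_of_tendsto_of_tendsto_of_le_of_le tendsto_const_nhds h2 (fun _ => zero_le)
    fun i => QuantumMetric.distQ_le_two_mul_propinquity C (X i) Y
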